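/- Let $D$ be a division ring, $n\ge 1$, and $B=D[x_1,\dots,x_n]$ the polynomial ring in variables that commute with each other and with the elements of $D$. Elements $t_1,\dots,t_m$ of $B$ are called variables of a subring $S\subseteq B$ containing $D$, and we say that $S=D[t_1,\dots,t_m]$ is a polynomial ring in the $t_i$, if there is a ring isomorphism from the polynomial ring over $D$ in $m$ variables onto $S$ that is the identity on $D$ and maps the $i$-th variable to $t_i$. A change of variables of $x_1,\dots,x_n$ is a family $t_1,\dots,t_n\in B$ such that $B=D[t_1,\dots,t_n]$ is a polynomial ring in the $t_i$. Modules are right modules; a module $M$ over a ring $R$ is torsion if for every $y\in M$ there is a regular element $d\in R$ (neither a left nor a right zero divisor) with $yd=0$. Let $M$ be a finitely generated right $B$-module. (a) If $M$ is a torsion $B$-module, then there is a change of variables $t_1,\dots,t_n$ of $x_1,\dots,x_n$ such that $M$ is finitely generated as a right module over $B_{n-1}=D[t_1,\dots,t_{n-1}]$. (b) Suppose $n\ge 2$, and let $t_1,\dots,t_n$ be any change of variables of $x_1,\dots,x_n$ such that $M$ is finitely generated and torsion as a right module over $B_{n-1}=D[t_1,\dots,t_{n-1}]$. Then there are $z_1,\dots,z_n\in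 B$ with $z_n=t_n$ such that $B_{n-1}=D[z_1,\dots,z_{n-1}]$ is a polynomial ring in $z_1,\dots,z_{n-1}$, $M$ is finitely generated as a right module over $D[z_1,\dots,z_{n-2}]$, and $B=D[z_1,\dots,z_n]$ is a polynomial ring in $z_1,\dots,z_n$. -/

import Mathlib

open MulOpposite

namespace DivRingPoly

/-- The polynomial ring `D[x₁, …, xₙ]` over a (not necessarily commutative) ring `D`, in variables
that commute with each other and with the elements of `D`. -/
abbrev PolyRing (D : Type*) [Ring D] (n : ℕ) : Type _ := AddMonoidAlgebra D (Fin n →₀ ℕ)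

/-- The constant polynomials, `D → D[x₁, …, xₙ]`. -/
noncomputable def const {D : Type*} [Ring D] (n : ℕ) : D →+* PolyRing D n :=
  AddMonoidAlgebra.singleZeroRingHom

/-- The variable `xᵢ` of `D[x₁, …, xₙ]`. -/
noncomputable def var (D : Type*) [Ring D] {n : ℕ} (i : Fin n) : PolyRing D n :=
  AddMonoidAlgebra.single (Finsupp.single i 1) 1

/-- A right `R`-module is a right module over each subring `S` of `R`, by restriction. -/
instance restrictRight {R : Type*} [Ring R] (S : Subring R) {M : Type*} [AddCommGroup M]
    [Module Rᵐᵒᵖ M] : Module (↥S)ᵐᵒᵖ M :=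
  Module.compHom M (RingHom.op S.subtype)

/-- The right `R`-module `M` is torsion: each `y ∈ M` has `y d = 0` for a regular `d ∈ R`. -/
def IsRightTorsion (R : Type*) [Ring R] (M : Type*) [AddCommGroup M] [Module Rᵐᵒᵖ M] : Prop :=
  ∀ y : M, ∃ d : R, IsRegular d ∧ op d • y = 0

/-- The subring `S` of `D[x₁, …, xₙ]` is the polynomial ring `D[t₁, …, tₘ]` in the variables
`t₁, …, tₘ`: there is an isomorphism of the polynomial ring in `m` variables onto `S` that is the
identity on `D` and sends the `i`-th variable to `tᵢ`. -/
def IsPolyRingIn {D : Type*} [Ring D] {n m : ℕ} (S : Subring (PolyRing D n))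
    (t : Fin m → PolyRing D n) : Prop :=
  ∃ e : PolyRing D m →+* PolyRing D n, Function.Injective e ∧ e.range = S ∧
    (∀ d : D, e (const m d) = const n d) ∧ ∀ i : Fin m, e (var D i) = t i

/-- `t₁, …, tₙ` is a change of variables of `x₁, …, xₙ`:
`D[x₁, …, xₙ] = D[t₁, …, tₙ]` is also the polynomial ring in the variables `tᵢ`. -/
def IsChangeOfVariables {D : Type*} [Ring D] {n : ℕ} (t : Fin n → PolyRing D n) : Prop :=
  IsPolyRingIn ⊤ t

/-- The subring `D[t₁, …, tₘ]` generated by `D` and the first `m` of the elements `t₁, …, tₙ`. -/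
noncomputable def firstVars {D : Type*} [Ring D] {n : ℕ} (t : Fin n → PolyRing D n) (m : ℕ) :
    Subring (PolyRing D n) :=
  Subring.closure (Set.range (const (D := D) n) ∪ t '' {i | (i : ℕ) < m})

end DivRingPoly

/-! The proof is Nagata's normalization trick, which survives noncommutative coefficients because
the variables are central. Write `x` for the last variable and put `zᵢ = xᵢ - x ^ (N ^ (k - i))` for
`i < k`, with indices `0, …, k`. Over `S = D[z₀, …, zₖ₋₁]` the monomial with exponents `αᵢ` is monic
in `x` of degree `∑ αᵢ N ^ (k - i)`. If all exponents are below `N`, these degrees are distinct by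
uniqueness of base-`N` digits. So a nonzero polynomial `d` has a single top monomial, and `d u` is
monic for `u` the inverse of its coefficient (`exists_isMonicOfDegree_mul_const`).

If `y d = 0` then `y (d u) = 0`, and division by the monic `d u` shows that finitely many `y x ^ j`
generate `y B` over `S` (`smul_mem_span_of_monic`). One `N` serves a finite generating set, which
gives (a). For (b), the same result is applied to `D[t₁, …, tₙ₋₁]`, itself a polynomial ring, and
the resulting automorphism is extended to `B` by fixing `tₙ`. -/

namespace DivRingPoly

/-! ### Homomorphisms of polynomial rings with central variables. -/

section PolyRing

variable {D : Type*} [Ring D] {n : ℕ}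

theorem single_mem_center (α : Fin n →₀ ℕ) :
    (AddMonoidAlgebra.single α 1 : PolyRing D n) ∈ Subring.center (PolyRing D n) := by
  rw [Subring.mem_center_iff]
  intro f
  induction f using AddMonoidAlgebra.induction_linear with
  | zero => simp
  | add f g hf hg => rw [add_mul, mul_add, hf, hg]
  | single β d => simp [AddMonoidAlgebra.single_mul_single, add_comm]

theorem var_mem_center (i : Fin n) : var D i ∈ Subring.center (PolyRing D n) :=
  single_mem_center _

/-- The variable `xᵢ` as an element of the center of the polynomial ring. -/
noncomputable def centralVar (D : Type*) [Ring D] {n : ℕ} (i : Fin n) :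
    Subring.center (PolyRing D n) :=
  ⟨var D i, var_mem_center i⟩

/-- The product is taken in the center, since an unordered product needs a commutative ring. -/
theorem single_eq (α : Fin n →₀ ℕ) (d : D) :
    (AddMonoidAlgebra.single α d : PolyRing D n) =
      const n d * (∏ i, centralVar D i ^ α i : Subring.center (PolyRing D n)) := by
  have h : ∀ s : Finset (Fin n), ((∏ i ∈ s, centralVar D i ^ α i :
      Subring.center (PolyRing D n)) : PolyRing D n) =
      AddMonoidAlgebra.single (∑ i ∈ s, Finsupp.single i (α i)) 1 := by
    intro s
    induction s using Finset.cons_induction with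
    | empty => simp [AddMonoidAlgebra.one_def]
    | cons a s ha ih =>
      rw [Finset.prod_cons, Finset.sum_cons, Subring.coe_mul, ih, Subring.coe_pow]
      simp [centralVar, var, AddMonoidAlgebra.single_pow, AddMonoidAlgebra.single_mul_single]
  rw [h, Finsupp.univ_sum_single]
  simp [const, AddMonoidAlgebra.single_mul_single]

theorem closure_const_var :
    Subring.closure (Set.range (const (D := D) n) ∪ Set.range (var D)) = ⊤ := by
  rw [eq_top_iff]
  rintro f -
  induction f using AddMonoidAlgebra.induction_linear with
  | zero => exact zero_mem _
  | add f g hf hg => exact add_mem hf hg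
  | single α d =>
    rw [single_eq]
    refine mul_mem (Subring.subset_closure (Or.inl ⟨d, rfl⟩)) ?_
    have : (∏ i, centralVar D i ^ α i) ∈ Subring.comap (Subring.center (PolyRing D n)).subtype
        (Subring.closure (Set.range (const (D := D) n) ∪ Set.range (var D))) :=
      Subring.prod_mem _ fun i _ => by
        refine pow_mem ?_ _
        exact Subring.subset_closure (Or.inr ⟨i, rfl⟩)
    exact this

theorem polyRing_hom_ext {R : Type*} [Ring R] {f g : PolyRing D n →+* R}
    (hc : ∀ d, f (const n d) = g (const n d)) (hv : ∀ i, f (var D i) = g (var D i)) : f = g := by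
  refine RingHom.eq_of_eqOn_set_dense closure_const_var ?_
  rintro _ (⟨d, rfl⟩ | ⟨i, rfl⟩)
  exacts [hc d, hv i]

theorem range_eq_closure {R : Type*} [Ring R] (f : PolyRing D n →+* R) :
    f.range = Subring.closure
      (Set.range (fun d => f (const n d)) ∪ Set.range fun i => f (var D i)) := by
  rw [RingHom.range_eq_map, ← closure_const_var, RingHom.map_closure, Set.image_union,
    ← Set.range_comp, ← Set.range_comp]
  rfl

/-- The homomorphism from the polynomial ring given on constants by `c` and sending the variables
to central elements `tᵢ`. -/
noncomputable def evalHom {R : Type*} [Ring R] (c : D →+* R) (t : Fin n → Subring.center R) :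
    PolyRing D n →+* R :=
  AddMonoidAlgebra.liftNCRingHom c
    { toFun := fun α => ((∏ i, t i ^ (Multiplicative.toAdd α) i : Subring.center R) : R)
      map_one' := by simp
      map_mul' := fun α β => by simp [pow_add, Finset.prod_mul_distrib] }
    fun d α => Subring.mem_center_iff.1
      (∏ i, t i ^ (Multiplicative.toAdd α) i : Subring.center R).2 (c d)

theorem evalHom_single {R : Type*} [Ring R] (c : D →+* R) (t : Fin n → Subring.center R)
    (α : Fin n →₀ ℕ) (d : D) :
    evalHom c t (AddMonoidAlgebra.single α d) =
      c d * (∏ i, t i ^ α i : Subring.center R) :=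
  AddMonoidAlgebra.liftNC_single _ _ _ _

@[simp]
theorem evalHom_const {R : Type*} [Ring R] (c : D →+* R) (t : Fin n → Subring.center R) (d : D) :
    evalHom c t (const n d) = c d :=
  (evalHom_single c t 0 d).trans (by simp)

@[simp]
theorem evalHom_var {R : Type*} [Ring R] (c : D →+* R) (t : Fin n → Subring.center R)
    (i : Fin n) : evalHom c t (var D i) = t i :=
  (evalHom_single c t _ 1).trans (by
    rw [Finset.prod_eq_single i] <;> simp +contextual [eq_comm])

/-- The triangular endomorphism `xᵢ ↦ xᵢ + ε xₚ ^ eᵢ` for `i < p`, fixing the other variables. -/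
noncomputable def shiftHom (D : Type*) [Ring D] {n : ℕ} (p : Fin n) (e : Fin n → ℕ) (ε : ℤ) :
    PolyRing D n →+* PolyRing D n :=
  evalHom (const n) fun i =>
    if i < p then centralVar D i + ε • centralVar D p ^ e i else centralVar D i

@[simp]
theorem shiftHom_const (p : Fin n) (e : Fin n → ℕ) (ε : ℤ) (d : D) :
    shiftHom D p e ε (const n d) = const n d :=
  evalHom_const _ _ _

theorem shiftHom_var (p : Fin n) (e : Fin n → ℕ) (ε : ℤ) (i : Fin n) :
    shiftHom D p e ε (var D i) = if i < p then var D i + ε • var D p ^ e i else var D i := by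
  rw [shiftHom, evalHom_var]
  split_ifs <;> simp [centralVar]

theorem shiftHom_comp_neg (p : Fin n) (e : Fin n → ℕ) (ε : ℤ) :
    (shiftHom D p e ε).comp (shiftHom D p e (-ε)) = RingHom.id _ := by
  refine polyRing_hom_ext (by simp) fun i => ?_
  by_cases h : i < p <;> simp [shiftHom_var, h]

theorem shiftHom_bijective (p : Fin n) (e : Fin n → ℕ) (ε : ℤ) :
    Function.Bijective (shiftHom D p e ε) := by
  refine Function.bijective_iff_has_inverse.2 ⟨shiftHom D p e (-ε), fun x => ?_, fun x => ?_⟩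
  · have h := shiftHom_comp_neg (D := D) p e (-ε)
    rw [neg_neg] at h
    exact DFunLike.congr_fun h x
  · exact DFunLike.congr_fun (shiftHom_comp_neg (D := D) p e ε) x

/-- The inclusion of the polynomial ring in the first `m` variables. -/
noncomputable def inclHom (D : Type*) [Ring D] {m n : ℕ} (h : m ≤ n) :
    PolyRing D m →+* PolyRing D n :=
  evalHom (const n) fun i => centralVar D (Fin.castLE h i)

@[simp]
theorem inclHom_const {m : ℕ} (h : m ≤ n) (d : D) : inclHom D h (const m d) = const n d :=
  evalHom_const _ _ _

@[simp]
theorem inclHom_var {m : ℕ} (h : m ≤ n) (i : Fin m) :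
    inclHom D h (var D i) = var D (Fin.castLE h i) :=
  evalHom_var _ _ _

theorem inclHom_injective {m : ℕ} (h : m ≤ n) : Function.Injective (inclHom D h) := by
  let g : PolyRing D n →+* PolyRing D m :=
    evalHom (const m) fun i => if hi : (i : ℕ) < m then centralVar D ⟨i, hi⟩ else 0
  have hg : g.comp (inclHom D h) = RingHom.id _ :=
    polyRing_hom_ext (by simp [g]) (by simp [g, centralVar])
  exact Function.LeftInverse.injective (g := g) (DFunLike.congr_fun hg)

/-- This extends a change of the first `m` variables to all `n` of them, as (b) requires. -/
theorem inclHom_comp_shiftHom {m : ℕ} (h : m ≤ n) (p : Fin m) (e : Fin n → ℕ) (ε : ℤ) :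
    (inclHom D h).comp (shiftHom D p (fun i => e (Fin.castLE h i)) ε) =
      (shiftHom D (Fin.castLE h p) e ε).comp (inclHom D h) := by
  refine polyRing_hom_ext (by simp) fun i => ?_
  by_cases hi : i < p <;> simp [shiftHom_var, hi]

end PolyRing

end DivRingPoly

/-! ### Filtration by degree in a central element, and division by monic elements. -/

namespace DivRingPoly

section Filtration

variable {R : Type*} [Ring R]

/-- The additive group of sums of terms `x ^ j * b` with `j < m` and `b ∈ S`. -/
def degreeLT (S : Subring R) (x : R) (m : ℕ) : AddSubgroup R :=
  AddSubgroup.closure {a | ∃ j < m, ∃ b ∈ S, a = x ^ j * b}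

variable {S : Subring R} {x : R}

theorem pow_mul_mem_degreeLT {j m : ℕ} (h : j < m) {b : R} (hb : b ∈ S) :
    x ^ j * b ∈ degreeLT S x m :=
  AddSubgroup.subset_closure ⟨j, h, b, hb, rfl⟩

theorem degreeLT_mono {m l : ℕ} (h : m ≤ l) : degreeLT S x m ≤ degreeLT S x l :=
  AddSubgroup.closure_mono fun _ ⟨j, hj, b, hb, hab⟩ => ⟨j, hj.trans_le h, b, hb, hab⟩

theorem mul_mem_degreeLT_of_mem {m : ℕ} {a b : R} (ha : a ∈ degreeLT S x m) (hb : b ∈ S) :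
    a * b ∈ degreeLT S x m := by
  induction ha using AddSubgroup.closure_induction with
  | mem a h =>
    obtain ⟨j, hj, c, hc, rfl⟩ := h
    rw [mul_assoc]
    exact pow_mul_mem_degreeLT hj (mul_mem hc hb)
  | zero => simp
  | add a c _ _ ha hc => rw [add_mul]; exact add_mem ha hc
  | neg a _ ha => rw [neg_mul]; exact neg_mem ha

theorem pow_mul_mem_degreeLT_add {m : ℕ} (l : ℕ) {a : R} (ha : a ∈ degreeLT S x m) :
    x ^ l * a ∈ degreeLT S x (l + m) := by
  induction ha using AddSubgroup.closure_induction with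
  | mem a h =>
    obtain ⟨j, hj, c, hc, rfl⟩ := h
    rw [← mul_assoc, ← pow_add]
    exact pow_mul_mem_degreeLT (by lia) hc
  | zero => simp
  | add a c _ _ ha hc => rw [mul_add]; exact add_mem ha hc
  | neg a _ ha => rw [mul_neg]; exact neg_mem ha

/-- Centrality of `x` lets its powers move to the left past the coefficients, which need not commute
with each other. -/
theorem mul_mem_degreeLT_add (hx : x ∈ Subring.center R) {m l : ℕ} {a b : R}
    (ha : a ∈ degreeLT S x m) (hb : b ∈ degreeLT S x l) : a * b ∈ degreeLT S x (m + l) := by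
  induction hb using AddSubgroup.closure_induction with
  | mem b h =>
    obtain ⟨j, hj, c, hc, rfl⟩ := h
    rw [← mul_assoc, Subring.mem_center_iff.1 (pow_mem hx j) a]
    exact mul_mem_degreeLT_of_mem (degreeLT_mono (by lia) (pow_mul_mem_degreeLT_add j ha)) hc
  | zero => simp
  | add b c _ _ hb hc => rw [mul_add]; exact add_mem hb hc
  | neg b _ hb => rw [mul_neg]; exact neg_mem hb

/-- `a` is monic of degree `m` in `x` with lower coefficients in `S`. -/
def IsMonicOfDegree (S : Subring R) (x : R) (m : ℕ) (a : R) : Prop :=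
  a - x ^ m ∈ degreeLT S x m

theorem isMonicOfDegree_one : IsMonicOfDegree S x 0 1 := by
  simp [IsMonicOfDegree]

theorem IsMonicOfDegree.mul (hx : x ∈ Subring.center R) {m l : ℕ} {a b : R}
    (ha : IsMonicOfDegree S x m a) (hb : IsMonicOfDegree S x l b) :
    IsMonicOfDegree S x (m + l) (a * b) := by
  have h : a * b - x ^ (m + l) = x ^ m * (b - x ^ l) + x ^ l * (a - x ^ m) +
      (a - x ^ m) * (b - x ^ l) := by
    rw [← Subring.mem_center_iff.1 (pow_mem hx l) (a - x ^ m), pow_add]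
    noncomm_ring
  rw [IsMonicOfDegree, h]
  refine add_mem (add_mem (pow_mul_mem_degreeLT_add m hb) ?_) (mul_mem_degreeLT_add hx ha hb)
  rw [add_comm m l]
  exact pow_mul_mem_degreeLT_add l ha

theorem IsMonicOfDegree.pow (hx : x ∈ Subring.center R) {m : ℕ} {a : R}
    (ha : IsMonicOfDegree S x m a) (k : ℕ) : IsMonicOfDegree S x (k * m) (a ^ k) := by
  induction k with
  | zero => simpa using isMonicOfDegree_one
  | succ k ih => rw [pow_succ, add_mul, one_mul]; exact ih.mul hx ha

theorem IsMonicOfDegree.prod {ι : Type*} (hx : x ∈ Subring.center R) (s : Finset ι) {m : ι → ℕ}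
    {a : ι → Subring.center R} (ha : ∀ i, IsMonicOfDegree S x (m i) (a i)) :
    IsMonicOfDegree S x (∑ i ∈ s, m i) (∏ i ∈ s, a i : Subring.center R) := by
  induction s using Finset.cons_induction with
  | empty => simpa using isMonicOfDegree_one
  | cons i s hi ih =>
    rw [Finset.prod_cons, Finset.sum_cons, Subring.coe_mul]
    exact (ha i).mul hx ih

theorem IsMonicOfDegree.mem_degreeLT {m : ℕ} {a : R} (ha : IsMonicOfDegree S x m a) {l : ℕ}
    (h : m < l) : a ∈ degreeLT S x l := by
  rw [← sub_add_cancel a (x ^ m)]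
  refine add_mem (degreeLT_mono h.le ha) ?_
  simpa using pow_mul_mem_degreeLT (x := x) h (one_mem S)

variable {M : Type*} [AddCommGroup M] [Module Rᵐᵒᵖ M]

theorem smul_mem_span_of_mem_degreeLT {m : ℕ} {y : M} {T : Submodule (↥S)ᵐᵒᵖ M}
    (hT : ∀ j < m, op (x ^ j) • y ∈ T) {a : R} (ha : a ∈ degreeLT S x m) : op a • y ∈ T := by
  induction ha using AddSubgroup.closure_induction with
  | mem a h =>
    obtain ⟨j, hj, c, hc, rfl⟩ := h
    rw [op_mul, mul_smul]
    exact T.smul_mem (op ⟨c, hc⟩) (hT j hj)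
  | zero => simp
  | add a c _ _ ha hc => rw [op_add, add_smul]; exact add_mem ha hc
  | neg a _ ha => rw [op_neg, neg_smul]; exact neg_mem ha

/-- If `y` is annihilated by a monic element, then the cyclic module generated by `y` is generated
over `S` by finitely many multiples `y x ^ j`. -/
theorem smul_mem_span_of_monic (hx : x ∈ Subring.center R)
    (hR : ∀ a : R, ∃ m, a ∈ degreeLT S x m) {m : ℕ} {d : R} (hd : IsMonicOfDegree S x m d)
    {y : M} (hy : op d • y = 0) (a : R) :
    op a • y ∈ Submodule.span (↥S)ᵐᵒᵖ ((fun j => op (x ^ j) • y) '' Set.Iio m) := by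
  obtain ⟨l, hl⟩ := hR a
  refine smul_mem_span_of_mem_degreeLT (fun j hjl => ?_) hl
  clear hl hjl
  induction j using Nat.strong_induction_on with
  | _ j ih =>
    rcases lt_or_ge j m with hj | hj
    · exact Submodule.subset_span ⟨j, hj, rfl⟩
    -- Division with remainder: in the right action `d` meets `y` first and kills it, and the
    -- remaining term has degree below `j`.
    · have h : x ^ j = d * x ^ (j - m) - x ^ (j - m) * (d - x ^ m) := by
        rw [Subring.mem_center_iff.1 (pow_mem hx (j - m)) d, mul_sub, ← pow_add,
          Nat.sub_add_cancel hj]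
        abel
      rw [h, op_sub, sub_smul, op_mul, mul_smul, hy, smul_zero, zero_sub]
      have hmem := pow_mul_mem_degreeLT_add (j - m) hd
      rw [Nat.sub_add_cancel hj] at hmem
      exact neg_mem (smul_mem_span_of_mem_degreeLT (fun i hi => ih i hi) hmem)

end Filtration

end DivRingPoly

/-! ### Nagata's substitution and torsion modules. -/

namespace DivRingPoly

/-- Transfers finiteness between rings that act through the same operators, without asking for a
homomorphism between them. -/
theorem finite_of_forall_exists_smul_eq {R S M : Type*} [Semiring R] [Semiring S]
    [AddCommMonoid M] [Module R M] [Module S M] (h : ∀ r : R, ∃ s : S, ∀ y : M, r • y = s • y)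
    [Module.Finite R M] : Module.Finite S M := by
  obtain ⟨G, hG⟩ := (Module.Finite.fg_top : (⊤ : Submodule R M).FG)
  refine ⟨G, eq_top_iff.2 fun y _ => ?_⟩
  have hy : y ∈ Submodule.span R (G : Set M) := hG ▸ Submodule.mem_top
  induction hy using Submodule.span_induction with
  | mem y h => exact Submodule.subset_span h
  | zero => exact zero_mem _
  | add y z _ _ hy hz => exact add_mem (hy trivial) (hz trivial)
  | smul r y _ hy =>
    obtain ⟨s, hs⟩ := h r
    rw [hs]
    exact Submodule.smul_mem _ _ (hy trivial)

/-- Uniqueness of base-`N` digits. The digit of index `0` is the most significant here but the least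
significant in `finFunctionFinEquiv`, hence the reversal. -/
theorem eq_of_sum_mul_pow_eq {k N : ℕ} {α β : Fin (k + 1) →₀ ℕ} (hα : ∀ i, α i < N)
    (hβ : ∀ i, β i < N)
    (h : ∑ i, α i * N ^ (k - (i : ℕ)) = ∑ i, β i * N ^ (k - (i : ℕ))) : α = β := by
  have key : ∀ γ : Fin (k + 1) →₀ ℕ, ∀ hγ : ∀ i, γ i < N,
      (finFunctionFinEquiv (fun i => (⟨γ (Fin.rev i), hγ _⟩ : Fin N)) : ℕ) =
        ∑ i, γ i * N ^ (k - (i : ℕ)) := by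
    intro γ hγ
    rw [finFunctionFinEquiv_apply, ← Equiv.sum_comp Fin.revPerm]
    refine Finset.sum_congr rfl fun i _ => ?_
    simp [Fin.val_rev]
  rw [← key α hα, ← key β hβ] at h
  have h' := finFunctionFinEquiv.injective (Fin.ext h)
  ext i
  simpa using congrArg Fin.val (congrFun h' (Fin.rev i))

/-- The change of variables `zᵢ = xᵢ - xₚ ^ (N ^ (p - i))` for `i < p`, and `zᵢ = xᵢ` otherwise. -/
noncomputable def nagataHom (D : Type*) [Ring D] {n : ℕ} (p : Fin n) (N : ℕ) :
    PolyRing D n →+* PolyRing D n :=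
  shiftHom D p (fun i => N ^ ((p : ℕ) - (i : ℕ))) (-1)

/-- The coefficient ring generated by `D` and the first `k` of the new variables. -/
noncomputable abbrev nagataSubring (D : Type*) [Ring D] (k N : ℕ) :
    Subring (PolyRing D (k + 1)) :=
  firstVars (fun i => nagataHom D (Fin.last k) N (var D i)) k

theorem const_mem_firstVars {D : Type*} [Ring D] {n : ℕ} (t : Fin n → PolyRing D n) (m : ℕ)
    (d : D) : const n d ∈ firstVars t m :=
  Subring.subset_closure (Or.inl ⟨d, rfl⟩)

section Nagata

variable {D : Type*} [Ring D] {k N : ℕ}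

/-- For `i < k`, `xᵢ` is `x ^ (N ^ (k - i))` plus `zᵢ`, a term of degree `0`; this is lower because
`N` is positive. The last variable fits the same formula, as `N ^ 0 = 1`. -/
theorem isMonicOfDegree_var (hN : 0 < N) (i : Fin (k + 1)) :
    IsMonicOfDegree (nagataSubring D k N) (var D (Fin.last k)) (N ^ (k - (i : ℕ))) (var D i) := by
  rw [IsMonicOfDegree]
  by_cases hi : i < Fin.last k
  · have hz : nagataHom D (Fin.last k) N (var D i) ∈ nagataSubring D k N :=
      Subring.subset_closure (Or.inr ⟨i, hi, rfl⟩)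
    have := pow_mul_mem_degreeLT (x := var D (Fin.last k)) (pow_pos hN (k - (i : ℕ))) hz
    simpa [nagataHom, shiftHom_var, hi, sub_eq_add_neg] using this
  · obtain rfl : i = Fin.last k := le_antisymm (Fin.le_last i) (not_lt.1 hi)
    simp

theorem isMonicOfDegree_single (hN : 0 < N) (α : Fin (k + 1) →₀ ℕ) :
    IsMonicOfDegree (nagataSubring D k N) (var D (Fin.last k)) (∑ i, α i * N ^ (k - (i : ℕ)))
      (AddMonoidAlgebra.single α 1) := by
  rw [single_eq, map_one, one_mul]
  exact IsMonicOfDegree.prod (var_mem_center _) _ fun i =>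
    (isMonicOfDegree_var hN i).pow (var_mem_center _) (α i)

theorem single_eq_mul_const {n : ℕ} (α : Fin n →₀ ℕ) (d : D) :
    (AddMonoidAlgebra.single α d : PolyRing D n) = AddMonoidAlgebra.single α 1 * const n d := by
  simp [const, AddMonoidAlgebra.single_mul_single]

theorem single_mem_degreeLT (hN : 0 < N) (α : Fin (k + 1) →₀ ℕ) (d : D) {m : ℕ}
    (h : ∑ i, α i * N ^ (k - (i : ℕ)) < m) :
    (AddMonoidAlgebra.single α d : PolyRing D (k + 1)) ∈
      degreeLT (nagataSubring D k N) (var D (Fin.last k)) m := by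
  rw [single_eq_mul_const]
  exact mul_mem_degreeLT_of_mem ((isMonicOfDegree_single hN α).mem_degreeLT h)
    (const_mem_firstVars _ _ d)

theorem exists_mem_degreeLT (hN : 0 < N) (a : PolyRing D (k + 1)) :
    ∃ m, a ∈ degreeLT (nagataSubring D k N) (var D (Fin.last k)) m := by
  induction a using AddMonoidAlgebra.induction_linear with
  | zero => exact ⟨0, zero_mem _⟩
  | add a b ha hb =>
    obtain ⟨m, hm⟩ := ha
    obtain ⟨l, hl⟩ := hb
    exact ⟨max m l, add_mem (degreeLT_mono (le_max_left _ _) hm)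
      (degreeLT_mono (le_max_right _ _) hl)⟩
  | single α d => exact ⟨_, single_mem_degreeLT hN α d (Nat.lt_succ_self _)⟩

end Nagata

/-- The support of `d` has a unique monomial of maximal weight, and the inverse of its coefficient
normalizes it. The constant multiplies on the right so that `d u` still annihilates whatever `d`
does in a right module. -/
theorem exists_isMonicOfDegree_mul_const {D : Type*} [DivisionRing D] {k N : ℕ} (hN : 0 < N)
    {d : PolyRing D (k + 1)} (hd : d ≠ 0) (h : ∀ α ∈ d.coeff.support, ∀ i, α i < N) :
    ∃ (m : ℕ) (u : D), IsMonicOfDegree (nagataSubring D k N) (var D (Fin.last k)) m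
      (d * const (k + 1) u) := by
  have hs : d.coeff.support.Nonempty := by simpa [Finset.nonempty_iff_ne_empty] using hd
  obtain ⟨α, hα, hmax⟩ := Finset.exists_max_image d.coeff.support
    (fun α => ∑ i, α i * N ^ (k - (i : ℕ))) hs
  have hu : d.coeff α ≠ 0 := Finsupp.mem_support_iff.1 hα
  refine ⟨∑ i, α i * N ^ (k - (i : ℕ)), (d.coeff α)⁻¹, ?_⟩
  have hsum : d * const (k + 1) (d.coeff α)⁻¹ = AddMonoidAlgebra.single α 1 +
      ∑ β ∈ d.coeff.support.erase α,
        AddMonoidAlgebra.single β (d.coeff β * (d.coeff α)⁻¹) := by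
    have hmul : ∀ u : D, d * const (k + 1) u =
        ∑ β ∈ d.coeff.support, AddMonoidAlgebra.single β (d.coeff β * u) := by
      intro u
      conv_lhs => rw [← AddMonoidAlgebra.sum_coeff_single d]
      rw [Finsupp.sum, Finset.sum_mul]
      simp [const, AddMonoidAlgebra.single_mul_single]
    rw [hmul, ← Finset.add_sum_erase _ _ hα, mul_inv_cancel₀ hu]
  rw [IsMonicOfDegree, hsum, add_sub_right_comm]
  refine add_mem (isMonicOfDegree_single hN α) (sum_mem fun β hβ => ?_)
  obtain ⟨hne, hβ⟩ := Finset.mem_erase.1 hβ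
  exact single_mem_degreeLT hN _ _ (lt_of_le_of_ne (hmax β hβ) fun he =>
    hne (eq_of_sum_mul_pow_eq (h β hβ) (h α hα) he))

/-- A finitely generated torsion module is finitely generated over the polynomial ring in one
variable less, after a suitable triangular change of variables. -/
theorem exists_finite_nagataSubring {D : Type*} [DivisionRing D] {k : ℕ} {M : Type*}
    [AddCommGroup M] [Module (PolyRing D (k + 1))ᵐᵒᵖ M] [Module.Finite (PolyRing D (k + 1))ᵐᵒᵖ M]
    (hM : IsRightTorsion (PolyRing D (k + 1)) M) :
    ∃ N, Module.Finite (↥(nagataSubring D k N))ᵐᵒᵖ M := by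
  obtain ⟨G, hG⟩ := (Module.Finite.fg_top : (⊤ : Submodule (PolyRing D (k + 1))ᵐᵒᵖ M).FG)
  choose d hd hy using hM
  -- A common bound for all exponents in the annihilators of the generators; `N + 1` is then used,
  -- which is also positive.
  obtain ⟨N, hN⟩ := (G.biUnion fun y => (d y).coeff.support.biUnion fun α =>
    Finset.univ.image α).exists_nat_subset_range
  have hlt : ∀ y ∈ G, ∀ α ∈ (d y).coeff.support, ∀ i, α i < N + 1 := fun y hyG α hα i =>
    Nat.lt_succ_of_lt (Finset.mem_range.1 (hN (by
      simp only [Finset.mem_biUnion, Finset.mem_image]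
      exact ⟨y, hyG, α, hα, i, Finset.mem_univ i, rfl⟩)))
  have hmonic : ∀ y : M, ∃ m, y ∈ G → ∃ u : D, IsMonicOfDegree (nagataSubring D k (N + 1))
      (var D (Fin.last k)) m (d y * const (k + 1) u) := by
    intro y
    by_cases hyG : y ∈ G
    · obtain ⟨m, u, h⟩ := exists_isMonicOfDegree_mul_const N.succ_pos (hd y).ne_zero (hlt y hyG)
      exact ⟨m, fun _ => ⟨u, h⟩⟩
    · exact ⟨0, fun h => absurd h hyG⟩
  choose m hm using hmonic
  refine ⟨N + 1, ⟨?_⟩⟩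
  rw [Submodule.fg_def]
  refine ⟨⋃ y ∈ G, (fun j => op (var D (Fin.last k) ^ j) • y) '' Set.Iio (m y),
    G.finite_toSet.biUnion fun y _ => (Set.finite_Iio _).image _, eq_top_iff.2 fun y _ => ?_⟩
  have hyG : y ∈ Submodule.span (PolyRing D (k + 1))ᵐᵒᵖ (G : Set M) := hG ▸ Submodule.mem_top
  -- The span is only known to be stable under `S`, so the induction over the whole ring carries all
  -- multiples `y a`.
  suffices h : ∀ a : PolyRing D (k + 1), op a • y ∈ Submodule.span
      (↥(nagataSubring D k (N + 1)))ᵐᵒᵖ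
      (⋃ y ∈ G, (fun j => op (var D (Fin.last k) ^ j) • y) '' Set.Iio (m y)) by
    simpa using h 1
  induction hyG using Submodule.span_induction with
  | mem y h =>
    intro a
    obtain ⟨u, hu⟩ := hm y h
    refine Submodule.span_mono (Set.subset_biUnion_of_mem (u := fun y =>
      (fun j => op (var D (Fin.last k) ^ j) • y) '' Set.Iio (m y)) h) ?_
    refine smul_mem_span_of_monic (var_mem_center _) (exists_mem_degreeLT N.succ_pos) hu ?_ a
    rw [op_mul, mul_smul, hy, smul_zero]
  | zero => simp
  | add y z _ _ hy hz =>
    intro a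
    rw [smul_add]
    exact add_mem (hy trivial a) (hz trivial a)
  | smul r y _ hy =>
    intro a
    rw [← mul_smul]
    exact hy trivial (r.unop * a)

/-! ### Changes of variables, and the passage from `n - 1` to `n - 2` variables. -/

theorem nagataHom_bijective {D : Type*} [Ring D] {n : ℕ} (p : Fin n) (N : ℕ) :
    Function.Bijective (nagataHom D p N) :=
  shiftHom_bijective _ _ _

theorem isChangeOfVariables_of_bijective {D : Type*} [Ring D] {n : ℕ}
    {f : PolyRing D n →+* PolyRing D n} (hf : Function.Bijective f)
    (hc : ∀ d, f (const n d) = const n d) : IsChangeOfVariables fun i => f (var D i) :=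
  ⟨f, hf.1, RingHom.range_eq_top.2 hf.2, hc, fun _ => rfl⟩

theorem nagataHom_const {D : Type*} [Ring D] {n : ℕ} (p : Fin n) (N : ℕ) (d : D) :
    nagataHom D p N (const n d) = const n d :=
  shiftHom_const _ _ _ _

theorem inclHom_comp_nagataHom {D : Type*} [Ring D] {m n : ℕ} (h : m ≤ n) (p : Fin m) (N : ℕ) :
    (inclHom D h).comp (nagataHom D p N) = (nagataHom D (Fin.castLE h p) N).comp (inclHom D h) :=
  inclHom_comp_shiftHom h p (fun i => N ^ ((p : ℕ) - (i : ℕ))) (-1)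

theorem range_comp_inclHom {D : Type*} [Ring D] {m n : ℕ} (h : m ≤ n)
    {f : PolyRing D n →+* PolyRing D n} (hc : ∀ d, f (const n d) = const n d) :
    (f.comp (inclHom D h)).range = firstVars (fun i => f (var D i)) m := by
  rw [range_eq_closure, firstVars]
  congr 2
  · simp [hc]
  · ext a
    constructor
    · rintro ⟨i, rfl⟩
      exact ⟨Fin.castLE h i, i.2, by simp⟩
    · rintro ⟨i, hi, rfl⟩
      exact ⟨⟨i, hi⟩, by simp⟩

/-- The map `f` below identifies the polynomial ring in `k + 1` variables with `firstVars t (k +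
1)`. Pulling the action back along it makes `M` a finitely generated torsion module to which
`exists_finite_nagataSubring` applies. -/
theorem exists_finite_firstVars_pred {D : Type*} [DivisionRing D] {k : ℕ} {M : Type*}
    [AddCommGroup M] [Module (PolyRing D (k + 2))ᵐᵒᵖ M] {t : Fin (k + 2) → PolyRing D (k + 2)}
    (ht : IsChangeOfVariables t) (hfin : Module.Finite (↥(firstVars t (k + 1)))ᵐᵒᵖ M)
    (htor : IsRightTorsion (↥(firstVars t (k + 1))) M) :
    ∃ z : Fin (k + 2) → PolyRing D (k + 2),
      IsPolyRingIn (firstVars t (k + 1))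
        (fun i : Fin (k + 1) => z (Fin.castLE (Nat.le_succ _) i)) ∧
      Module.Finite (↥(firstVars z k))ᵐᵒᵖ M ∧
      z (Fin.last (k + 1)) = t (Fin.last (k + 1)) ∧ IsChangeOfVariables z := by
  obtain ⟨e, he, hrange, hc, hv⟩ := ht
  obtain rfl : (fun i => e (var D i)) = t := funext hv
  have hle : k + 1 ≤ k + 2 := Nat.le_succ _
  set f : PolyRing D (k + 1) →+* PolyRing D (k + 2) := e.comp (inclHom D hle) with hf
  have hfinj : Function.Injective f := he.comp (inclHom_injective hle)
  have hfr : f.range = firstVars (fun i => e (var D i)) (k + 1) := range_comp_inclHom hle hc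
  let _ : Module (PolyRing D (k + 1))ᵐᵒᵖ M := Module.compHom M (RingHom.op f)
  have hex : ∀ s : firstVars (fun i => e (var D i)) (k + 1), ∃ a, f a = s := fun s =>
    RingHom.mem_range.1 (hfr.symm ▸ s.2 : (s : PolyRing D (k + 2)) ∈ f.range)
  have : Module.Finite (PolyRing D (k + 1))ᵐᵒᵖ M := by
    refine finite_of_forall_exists_smul_eq
      (R := (↥(firstVars (fun i => e (var D i)) (k + 1)))ᵐᵒᵖ) fun s => ?_
    obtain ⟨a, ha⟩ := hex s.unop
    refine ⟨op a, fun y => ?_⟩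
    change op (s.unop : PolyRing D (k + 2)) • y = op (f a) • y
    rw [ha]
  have htor' : IsRightTorsion (PolyRing D (k + 1)) M := by
    intro y
    obtain ⟨s, hs, hsy⟩ := htor y
    obtain ⟨a, ha⟩ := hex s
    refine ⟨a, ?_, ?_⟩
    -- Regularity passes from `s = f a` back to `a` because `f` is injective with values in the
    -- subring.
    · have hmem : ∀ b, f b ∈ firstVars (fun i => e (var D i)) (k + 1) := fun b => hfr ▸ ⟨b, rfl⟩
      refine ⟨fun b c hbc => hfinj ?_, fun b c hbc => hfinj ?_⟩
      · refine congrArg Subtype.val (hs.left (a₁ := ⟨f b, hmem b⟩) (a₂ := ⟨f c, hmem c⟩)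
          (Subtype.ext ?_))
        simpa [ha] using congrArg f hbc
      · refine congrArg Subtype.val (hs.right (a₁ := ⟨f b, hmem b⟩) (a₂ := ⟨f c, hmem c⟩)
          (Subtype.ext ?_))
        simpa [ha] using congrArg f hbc
    · change op (f a) • y = 0
      rw [ha]
      exact hsy
  obtain ⟨N, hN⟩ := exists_finite_nagataSubring htor'
  -- The pivot is the last but one of the `k + 2` variables, so `nagataHom D p N` restricts to the
  -- substitution in the first `k + 1` variables and fixes the last one.
  set p : Fin (k + 2) := Fin.castLE hle (Fin.last k) with hp
  have hz : ∀ i : Fin (k + 1), f (nagataHom D (Fin.last k) N (var D i)) =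
      e (nagataHom D p N (var D (Fin.castLE hle i))) := fun i => by
    have := DFunLike.congr_fun (inclHom_comp_nagataHom (D := D) hle (Fin.last k) N) (var D i)
    simp only [RingHom.comp_apply, inclHom_var] at this
    rw [hf, RingHom.comp_apply, this]
  refine ⟨fun i => e (nagataHom D p N (var D i)), ⟨f.comp (nagataHom D (Fin.last k) N),
    hfinj.comp (nagataHom_bijective _ _).1, ?_, fun d => ?_, hz⟩, ?_, ?_, ?_⟩
  · rw [← hfr]
    ext a
    simp only [RingHom.mem_range, RingHom.comp_apply]
    exact ((nagataHom_bijective (Fin.last k) N).2.exists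
      (p := fun b : PolyRing D (k + 1) => f b = a)).symm
  · simp [hf, nagataHom_const, hc]
  · refine finite_of_forall_exists_smul_eq (R := (↥(nagataSubring D k N))ᵐᵒᵖ) fun s => ?_
    -- `f` carries the generators of the Nagata subring to constants and to the first `k` of the new
    -- variables.
    have hmem : nagataSubring D k N ≤
        (firstVars (fun i => e (nagataHom D p N (var D i))) k).comap f := by
      refine Subring.closure_le.2 ?_
      rintro _ (⟨d, rfl⟩ | ⟨i, hi, rfl⟩)
      · have : f (const (k + 1) d) = const (k + 2) d := by simp [hf, hc]
        simpa [this] using const_mem_firstVars _ _ d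
      · exact Subring.subset_closure (Or.inr ⟨Fin.castLE hle i, hi, (hz i).symm⟩)
    exact ⟨op ⟨f s.unop, hmem s.unop.2⟩, fun y => rfl⟩
  · have : ¬ Fin.last (k + 1) < p := not_lt.2 (Fin.le_last _)
    simp [nagataHom, shiftHom_var, this]
  · exact isChangeOfVariables_of_bijective (f := e.comp (nagataHom D p N))
      (Function.Bijective.comp (g := e) ⟨he, RingHom.range_eq_top.1 hrange⟩ (nagataHom_bijective p N))
      fun d => by simp [nagataHom_const, hc]

end DivRingPoly

theorem mainTheorem3 {D : Type*} [DivisionRing D] (n : ℕ)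
    {M : Type*} [AddCommGroup M] [Module (DivRingPoly.PolyRing D n)ᵐᵒᵖ M]
    [Module.Finite (DivRingPoly.PolyRing D n)ᵐᵒᵖ M] :
    (1 ≤ n → DivRingPoly.IsRightTorsion (DivRingPoly.PolyRing D n) M →
      ∃ t : Fin n → DivRingPoly.PolyRing D n, DivRingPoly.IsChangeOfVariables t ∧
        Module.Finite (↥(DivRingPoly.firstVars t (n - 1)))ᵐᵒᵖ M) ∧
    (∀ hn : 2 ≤ n, ∀ t : Fin n → DivRingPoly.PolyRing D n, DivRingPoly.IsChangeOfVariables t →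
      Module.Finite (↥(DivRingPoly.firstVars t (n - 1)))ᵐᵒᵖ M →
      DivRingPoly.IsRightTorsion (↥(DivRingPoly.firstVars t (n - 1))) M →
      ∃ z : Fin n → DivRingPoly.PolyRing D n,
        DivRingPoly.IsPolyRingIn (DivRingPoly.firstVars t (n - 1))
          (fun i : Fin (n - 1) => z (Fin.castLE (Nat.sub_le n 1) i)) ∧
        Module.Finite (↥(DivRingPoly.firstVars z (n - 2)))ᵐᵒᵖ M ∧
        z ⟨n - 1, by omega⟩ = t ⟨n - 1, by omega⟩ ∧
        DivRingPoly.IsChangeOfVariables z) := by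
  refine ⟨fun hn hM => ?_, fun hn t ht hfin htor => ?_⟩
  · obtain ⟨k, rfl⟩ := Nat.exists_eq_add_of_le' hn
    obtain ⟨N, hN⟩ := DivRingPoly.exists_finite_nagataSubring hM
    exact ⟨_, DivRingPoly.isChangeOfVariables_of_bijective
      (DivRingPoly.nagataHom_bijective (Fin.last k) N) (DivRingPoly.nagataHom_const _ _), hN⟩
  · obtain ⟨k, rfl⟩ := Nat.exists_eq_add_of_le' hn
    exact DivRingPoly.exists_finite_firstVars_pred ht hfin htor
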